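/- Let $m,n\in\mathbb{N}$, let $A\in\mathbb{R}^{m\times m}$ be a matrix all of whose complex eigenvalues have strictly positive real part, let $\sigma\in\mathbb{R}^{m\times n}$, and let $B$ be a standard Brownian motion in $\mathbb{R}^n$. For $x\in\mathbb{R}^m$ let $X(x)=(X_t(x))_{t\ge 0}$ be the solution of $\mathrm{d}X_t(x)=-AX_t(x)\,\mathrm{d}t+\sigma\,\mathrm{d}B_t$, $X_0(x)=x$, and let $\mu$ be the stationary probability distribution of this equation, i.e. the probability measure on $\mathbb{R}^m$ with $\int \mathbb{P}(X_t(x)\in S)\,\mu(\mathrm{d}x)=\mu(S)$ for all $t\ge 0$ and all Borel sets $S\subset\mathbb{R}^m$. Put $$\Sigma_t:=\int_0^t e^{-As}\sigma\sigma^*e^{-A^*s}\,\mathrm{d}s,\qquad \Sigma_\infty:=\int_0^\infty e^{-As}\sigma\sigma^*e^{-A^*s}\,\mathrm{d}s .$$ Let $\mathcal{W}_2(\mu_1,\mu_2)=\big(\inf_{\mathcal{T}}\int|u-v|^2\,\mathcal{T}(\mathrm{d}u,\mathrm{d}v)\big)^{1/2}$, the infimum being over all couplings $\mathcal{T}$ of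 $\mu_1$ and $\mu_2$, where $|\cdot|$ is the Euclidean norm; a random variable as an argument of $\mathcal{W}_2$ stands for its law. Let $\|M\|=\big(\sum_{i,j}M_{i,j}^2\big)^{1/2}$ be the Frobenius norm, and let $\mathcal{N}(a,C)$ be the normal distribution with mean $a$ and covariance matrix $C$. Then for all $t\ge 0$ and $x\in\mathbb{R}^m$ $$\mathcal{W}_2(X_t(x),\mu)=\mathcal{W}_2\big(\mathcal{N}(e^{-At}x,\Sigma_t),\mathcal{N}(0,\Sigma_\infty)\big)\le\Big(|e^{-At}x|^2+\|\Sigma_t^{1/2}-\Sigma_\infty^{1/2}\|^2\Big)^{1/2},$$ and therefore also $$\mathcal{W}_2(X_t(x),\mu)\le\Big(|e^{-At}x|^2+m\|\Sigma_t^{1/2}-\Sigma_\infty^{1/2}\|^2\Big)^{1/2}.$$ If, in addition, $\Sigma_t$ commutes with $\Sigma_\infty$, then $$\mathcal{W}_2(X_t(x),\mu)=\Big(|e^{-At}x|^2+\|\Sigma_t^{1/2}-\Sigma_\infty^{1/2}\|^2\Big)^{1/2}.$$ -/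

import Mathlib

open MeasureTheory ProbabilityTheory
open scoped NNReal ENNReal Matrix MatrixOrder

noncomputable section

/-- `T` is a coupling of `μ₁` and `μ₂`: a measure on the product with these marginals. -/
def IsCoupling {E : Type*} [MeasurableSpace E] (μ₁ μ₂ : Measure E) (T : Measure (E × E)) : Prop :=
  (∀ S : Set E, MeasurableSet S → T (S ×ˢ Set.univ) = μ₁ S) ∧
    ∀ S : Set E, MeasurableSet S → T (Set.univ ×ˢ S) = μ₂ S

/-- The Wasserstein distance of order `p > 0`, with values in `[0, ∞]`:
`(inf_T ∫ |u - v|^p T(du, dv)) ^ min (1, 1 / p)` over all couplings `T`. -/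
def wasserstein {E : Type*} [NormedAddCommGroup E] [MeasurableSpace E]
    (p : ℝ) (μ₁ μ₂ : Measure E) : ℝ≥0∞ :=
  (⨅ (T : Measure (E × E)) (_ : IsCoupling μ₁ μ₂ T), ∫⁻ z, ‖z.1 - z.2‖ₑ ^ p ∂T) ^ min 1 (1 / p)

/-- All complex eigenvalues of the real matrix `A` have strictly positive real part. -/
def HasPositiveSpectrum {m : ℕ} (A : Matrix (Fin m) (Fin m) ℝ) : Prop :=
  ∀ z ∈ spectrum ℂ (A.map (algebraMap ℝ ℂ)), 0 < z.re

/-- Standard Brownian motion in `ℝⁿ`: the coordinates are independent standard real Brownian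
motions. -/
structure IsStdBrownian {Ω : Type*} [MeasurableSpace Ω] {n : ℕ}
    (B : ℝ≥0 → Ω → EuclideanSpace ℝ (Fin n)) (P : Measure Ω) : Prop where
  coord : ∀ i, IsBrownianReal (fun t ω ↦ B t ω i) P
  indep : iIndepFun (fun i ω t ↦ B t ω i) P

/-- `X` is a solution of `dX = -A X dt + σ dB`, `X₀ = x`: a process with almost surely continuous
paths such that almost surely `X_t = x - ∫₀ᵗ A X_s ds + σ B_t` for all `t ≥ 0`. The dispersion
matrix is constant and `B` starts in `0`, so `∫₀ᵗ σ dB_s = σ B_t`. -/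
structure IsOUSolution {Ω : Type*} [MeasurableSpace Ω] {m n : ℕ}
    (A : Matrix (Fin m) (Fin m) ℝ) (σ : Matrix (Fin m) (Fin n) ℝ)
    (B : ℝ≥0 → Ω → EuclideanSpace ℝ (Fin n)) (P : Measure Ω) (x : EuclideanSpace ℝ (Fin m))
    (X : ℝ≥0 → Ω → EuclideanSpace ℝ (Fin m)) : Prop where
  aemeasurable : ∀ t, AEMeasurable (X t) P
  continuous_paths : ∀ᵐ ω ∂P, Continuous fun t ↦ X t ω
  equation : ∀ᵐ ω ∂P, ∀ t : ℝ≥0,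
    X t ω = x - (∫ s in (0 : ℝ)..t, A.toEuclideanLin (X s.toNNReal ω)) + σ.toEuclideanLin (B t ω)

/-- `μ` is stationary for the dynamics `x ↦ X(x)`: when the initial state is distributed according
to `μ`, the state at each time `t` is distributed according to `μ`. -/
def IsStationaryLaw {Ω : Type*} [MeasurableSpace Ω] {m : ℕ} (P : Measure Ω)
    (X : EuclideanSpace ℝ (Fin m) → ℝ≥0 → Ω → EuclideanSpace ℝ (Fin m))
    (μ : Measure (EuclideanSpace ℝ (Fin m))) : Prop :=
  ∀ (t : ℝ≥0) (S : Set (EuclideanSpace ℝ (Fin m))), MeasurableSet S →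
    ∫⁻ x, P.map (X x t) S ∂μ = μ S

/-- `e^{-At}`. -/
def expNeg {m : ℕ} (A : Matrix (Fin m) (Fin m) ℝ) (t : ℝ) : Matrix (Fin m) (Fin m) ℝ :=
  NormedSpace.exp (-t • A)

/-- `Σ_t = ∫₀ᵗ e^{-As} σ σ* e^{-A*s} ds`, entrywise. -/
def covAt {m n : ℕ} (A : Matrix (Fin m) (Fin m) ℝ) (σ : Matrix (Fin m) (Fin n) ℝ) (t : ℝ) :
    Matrix (Fin m) (Fin m) ℝ :=
  Matrix.of fun i j ↦ ∫ s in (0 : ℝ)..t, (expNeg A s * σ * σᵀ * expNeg Aᵀ s) i j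

/-- `Σ_∞ = ∫₀^∞ e^{-As} σ σ* e^{-A*s} ds`, entrywise. -/
def covInfty {m n : ℕ} (A : Matrix (Fin m) (Fin m) ℝ) (σ : Matrix (Fin m) (Fin n) ℝ) :
    Matrix (Fin m) (Fin m) ℝ :=
  Matrix.of fun i j ↦ ∫ s in Set.Ioi (0 : ℝ), (expNeg A s * σ * σᵀ * expNeg Aᵀ s) i j

/-- The square of the Frobenius norm. -/
def frobeniusSq {m n : ℕ} (M : Matrix (Fin m) (Fin n) ℝ) : ℝ :=
  ∑ i, ∑ j, M i j ^ 2

end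

/-!
By variation of constants, `X_t(x) - e^{-At} x` is almost surely a limit of Riemann–Stieltjes sums
of the Brownian path, hence a limit of sums of independent Gaussian increments, and its
characteristic function is that of `N(0, Σ_t)`. Stationarity then says that `μ` is the convolution
of its image under `e^{-At}` with `N(0, Σ_t)`. As `t → ∞`, `e^{-At}` decays exponentially (Gelfand's
formula and the spectral mapping theorem for `exp`), which forces `μ = N(0, Σ_∞)`.

For covariance matrices `S` and `T`, the coupling `z ↦ (a + S^{1/2} z, b + T^{1/2} z)` of a standard
normal vector gives the upper bound. If `S` and `T` commute, then in a common orthonormal eigenbasis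
`f`, for every coupling, the second moment of the difference of the `i`-th coordinates is at least
`⟪f i, a - b⟫ ^ 2` plus the square of the difference of the two standard deviations, and these lower
bounds add up to the upper bound.
-/

open Filter Topology
open scoped RealInnerProductSpace

section SecondMoments

variable {Ω : Type*} [MeasurableSpace Ω] {P : Measure Ω}

lemma covariance_le_sqrt_variance_mul_sqrt_variance [IsFiniteMeasure P] {f g : Ω → ℝ}
    (hf : MemLp f 2 P) (hg : MemLp g 2 P) : cov[f, g; P] ≤ √Var[f; P] * √Var[g; P] := by
  have hquad (c : ℝ) : 0 ≤ Var[f; P] * (c * c) + -2 * cov[f, g; P] * c + Var[g; P] := by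
    have h := variance_nonneg (fun ω ↦ c * f ω - g ω) P
    rw [variance_fun_sub (hf.const_mul c) hg, variance_const_mul, covariance_const_mul_left] at h
    linarith
  have hdiscrim := discrim_le_zero hquad
  rw [← Real.sqrt_mul (variance_nonneg f P)]
  refine Real.le_sqrt_of_sq_le ?_
  rw [discrim] at hdiscrim
  linarith

lemma sq_sqrt_variance_sub_sqrt_variance_le [IsFiniteMeasure P] {f g : Ω → ℝ}
    (hf : MemLp f 2 P) (hg : MemLp g 2 P) :
    (√Var[f; P] - √Var[g; P]) ^ 2 ≤ Var[fun ω ↦ f ω - g ω; P] := by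
  have hcov := covariance_le_sqrt_variance_mul_sqrt_variance hf hg
  rw [variance_fun_sub hf hg, sub_sq, Real.sq_sqrt (variance_nonneg f P),
    Real.sq_sqrt (variance_nonneg g P)]
  linarith

variable {E ι : Type*} [NormedAddCommGroup E] [InnerProductSpace ℝ E] [Fintype ι]

lemma integral_norm_sq_eq_add_sum_variance [IsProbabilityMeasure P] (b : OrthonormalBasis ι ℝ E)
    {Z : Ω → E} (hZ : MemLp Z 2 P) :
    ∫ ω, ‖Z ω‖ ^ 2 ∂P = ‖P[Z]‖ ^ 2 + ∑ i, Var[fun ω ↦ ⟪b i, Z ω⟫; P] := by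
  have : FiniteDimensional ℝ E := b.toBasis.finiteDimensional_of_finite
  have hcoord (i : ι) : MemLp (fun ω ↦ ⟪b i, Z ω⟫) 2 P := hZ.const_inner (b i)
  simp_rw [← b.sum_sq_inner_right]
  rw [integral_finsetSum _ fun i _ ↦ (hcoord i).integrable_sq, ← Finset.sum_add_distrib]
  refine Finset.sum_congr rfl fun i _ ↦ ?_
  rw [variance_eq_sub (hcoord i), integral_inner (hZ.integrable one_le_two)]
  simp only [Pi.pow_apply, add_sub_cancel]

lemma lintegral_enorm_rpow_two_eq [IsProbabilityMeasure P] (b : OrthonormalBasis ι ℝ E)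
    {Z : Ω → E} (hZ : MemLp Z 2 P) :
    ∫⁻ ω, ‖Z ω‖ₑ ^ (2 : ℝ) ∂P =
      ENNReal.ofReal (‖P[Z]‖ ^ 2 + ∑ i, Var[fun ω ↦ ⟪b i, Z ω⟫; P]) := by
  rw [← integral_norm_sq_eq_add_sum_variance b hZ,
    ofReal_integral_eq_lintegral_ofReal hZ.norm.integrable_sq (ae_of_all _ fun _ ↦ sq_nonneg _)]
  simp_rw [ENNReal.rpow_two, ENNReal.ofReal_pow (norm_nonneg _), ofReal_norm]

end SecondMoments

section Wasserstein

variable {E : Type*} [MeasurableSpace E] {μ₁ μ₂ : Measure E} {T : Measure (E × E)}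

lemma IsCoupling.measurePreserving_fst (hT : IsCoupling μ₁ μ₂ T) :
    MeasurePreserving Prod.fst T μ₁ := by
  refine ⟨measurable_fst, Measure.ext fun S hS ↦ ?_⟩
  rw [Measure.map_apply measurable_fst hS, ← hT.1 S hS, Set.prod_univ]

lemma IsCoupling.measurePreserving_snd (hT : IsCoupling μ₁ μ₂ T) :
    MeasurePreserving Prod.snd T μ₂ := by
  refine ⟨measurable_snd, Measure.ext fun S hS ↦ ?_⟩
  rw [Measure.map_apply measurable_snd hS, ← hT.2 S hS, Set.univ_prod]

lemma isCoupling_map_prodMk {Ω : Type*} [MeasurableSpace Ω] (P : Measure Ω) {f g : Ω → E}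
    (hf : Measurable f) (hg : Measurable g) :
    IsCoupling (P.map f) (P.map g) (P.map fun ω ↦ (f ω, g ω)) := by
  refine ⟨fun S hS ↦ ?_, fun S hS ↦ ?_⟩
  · rw [Measure.map_apply (hf.prodMk hg) (hS.prod .univ), Measure.map_apply hf hS]
    simp only [Set.mk_preimage_prod, Set.preimage_univ, Set.inter_univ]
  · rw [Measure.map_apply (hf.prodMk hg) (MeasurableSet.univ.prod hS), Measure.map_apply hg hS]
    simp only [Set.mk_preimage_prod, Set.preimage_univ, Set.univ_inter]

section NormedAddCommGroup

variable [NormedAddCommGroup E]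

lemma ofReal_sqrt_le_wasserstein_two {r : ℝ}
    (h : ∀ T, IsCoupling μ₁ μ₂ T → ENNReal.ofReal r ≤ ∫⁻ z, ‖z.1 - z.2‖ₑ ^ (2 : ℝ) ∂T) :
    ENNReal.ofReal √r ≤ wasserstein 2 μ₁ μ₂ := by
  rcases le_total r 0 with hr | hr
  · simp only [Real.sqrt_eq_zero_of_nonpos hr, ENNReal.ofReal_zero, zero_le]
  · rw [wasserstein, min_eq_right (by norm_num), Real.sqrt_eq_rpow,
      ← ENNReal.ofReal_rpow_of_nonneg hr (by norm_num)]
    gcongr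
    exact le_iInf₂ h

lemma wasserstein_two_map_map_le {Ω : Type*} [MeasurableSpace Ω] (P : Measure Ω) [BorelSpace E]
    [SecondCountableTopology E] {f g : Ω → E} (hf : Measurable f) (hg : Measurable g) :
    wasserstein 2 (P.map f) (P.map g) ≤
      (∫⁻ ω, ‖f ω - g ω‖ₑ ^ (2 : ℝ) ∂P) ^ (1 / 2 : ℝ) := by
  rw [wasserstein, min_eq_right (by norm_num)]
  gcongr
  refine (iInf₂_le _ (isCoupling_map_prodMk P hf hg)).trans_eq ?_
  exact lintegral_map (by fun_prop) (hf.prodMk hg)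

end NormedAddCommGroup

variable {ι : Type*} [NormedAddCommGroup E] [InnerProductSpace ℝ E] [BorelSpace E] [Fintype ι]

-- The difference of the two components of a coupling has a prescribed mean, and in each direction
-- its standard deviation is at least the difference of the two standard deviations.
theorem ofReal_sqrt_le_wasserstein_two_of_memLp [IsProbabilityMeasure μ₁]
    (b : OrthonormalBasis ι ℝ E) (h₁ : MemLp id 2 μ₁) (h₂ : MemLp id 2 μ₂) :
    ENNReal.ofReal √(‖μ₁[id] - μ₂[id]‖ ^ 2 +
      ∑ i, (√Var[fun u ↦ ⟪b i, u⟫; μ₁] - √Var[fun u ↦ ⟪b i, u⟫; μ₂]) ^ 2) ≤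
      wasserstein 2 μ₁ μ₂ := by
  refine ofReal_sqrt_le_wasserstein_two fun T hT ↦ ?_
  have hfst := hT.measurePreserving_fst
  have hsnd := hT.measurePreserving_snd
  have : IsProbabilityMeasure T := by
    rwa [← Measure.isProbabilityMeasure_map_iff measurable_fst.aemeasurable, hfst.map_eq]
  have hT₁ : MemLp (fun z : E × E ↦ z.1) 2 T := h₁.comp_measurePreserving hfst
  have hT₂ : MemLp (fun z : E × E ↦ z.2) 2 T := h₂.comp_measurePreserving hsnd
  have hmean₁ : ∫ z, z.1 ∂T = μ₁[id] := by
    rw [← hfst.map_eq]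
    exact (integral_map measurable_fst.aemeasurable (hfst.map_eq.symm ▸ h₁.1)).symm
  have hmean₂ : ∫ z, z.2 ∂T = μ₂[id] := by
    rw [← hsnd.map_eq]
    exact (integral_map measurable_snd.aemeasurable (hsnd.map_eq.symm ▸ h₂.1)).symm
  rw [lintegral_enorm_rpow_two_eq b (Z := fun z : E × E ↦ z.1 - z.2) (hT₁.sub hT₂),
    integral_sub (hT₁.integrable one_le_two) (hT₂.integrable one_le_two), hmean₁, hmean₂]
  gcongr with i
  have hb {μ : Measure E} : AEMeasurable (fun u ↦ ⟪b i, u⟫) μ := by fun_prop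
  rw [← hfst.variance_fun_comp hb, ← hsnd.variance_fun_comp hb]
  simp_rw [inner_sub_right]
  exact sq_sqrt_variance_sub_sqrt_variance_le (hT₁.const_inner (b i)) (hT₂.const_inner (b i))

end Wasserstein

section HilbertSchmidt

variable {E F ι κ : Type*} [NormedAddCommGroup E] [InnerProductSpace ℝ E] [CompleteSpace E]
  [NormedAddCommGroup F] [InnerProductSpace ℝ F] [CompleteSpace F] [Fintype ι] [Fintype κ]

lemma sum_norm_sq_adjoint_apply (b : OrthonormalBasis ι ℝ E) (e : OrthonormalBasis κ ℝ F)
    (T : E →L[ℝ] F) : ∑ j, ‖T.adjoint (e j)‖ ^ 2 = ∑ i, ‖T (b i)‖ ^ 2 := by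
  simp_rw [← b.sum_sq_inner_left, ← e.sum_sq_inner_right, ContinuousLinearMap.adjoint_inner_left]
  exact Finset.sum_comm

end HilbertSchmidt

section Frobenius

variable {m : ℕ}

lemma frobeniusSq_nonneg {n : ℕ} (M : Matrix (Fin m) (Fin n) ℝ) : 0 ≤ frobeniusSq M :=
  Finset.sum_nonneg fun _ _ ↦ Finset.sum_nonneg fun _ _ ↦ sq_nonneg _

lemma frobeniusSq_eq_sum_norm_sq {ι : Type*} [Fintype ι] (M : Matrix (Fin m) (Fin m) ℝ)
    (b : OrthonormalBasis ι ℝ (EuclideanSpace ℝ (Fin m))) :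
    frobeniusSq M = ∑ i, ‖Matrix.toEuclideanCLM (𝕜 := ℝ) M (b i)‖ ^ 2 := by
  let e := EuclideanSpace.basisFun (Fin m) ℝ
  rw [← sum_norm_sq_adjoint_apply b e, sum_norm_sq_adjoint_apply e e, frobeniusSq,
    Finset.sum_comm]
  simp [EuclideanSpace.real_norm_sq_eq, e]

end Frobenius

section CommutingOperators

variable {E : Type*} [NormedAddCommGroup E] [InnerProductSpace ℝ E] [FiniteDimensional ℝ E]
  {S T : E →ₗ[ℝ] E}

lemma exists_orthonormalBasis_of_isSymmetric_of_commute (hS : S.IsSymmetric) (hT : T.IsSymmetric)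
    (h : Commute S T) :
    ∃ (b : OrthonormalBasis (Fin (Module.finrank ℝ E)) ℝ E) (s t : Fin (Module.finrank ℝ E) → ℝ),
      ∀ i, S (b i) = s i • b i ∧ T (b i) = t i • b i := by
  classical
  let V := fun i : ℝ × ℝ ↦ Module.End.eigenspace S i.2 ⊓ Module.End.eigenspace T i.1
  have hinternal : DirectSum.IsInternal V := hS.directSum_isInternal_of_commute hT h
  have hortho : OrthogonalFamily ℝ (fun i ↦ V i) fun i ↦ (V i).subtypeₗᵢ :=
    LinearMap.IsSymmetric.orthogonalFamily_eigenspace_inf_eigenspace hS hT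
  let J := {i // V i ≠ ⊥}
  have : Fintype J := hinternal.submodule_iSupIndep.fintypeNeBotOfFiniteDimensional
  have hinternal' : DirectSum.IsInternal fun j : J ↦ V j :=
    DirectSum.isInternal_ne_bot_iff.2 hinternal
  have hortho' : OrthogonalFamily ℝ (fun j : J ↦ V j) fun j ↦ (V j).subtypeₗᵢ :=
    hortho.comp Subtype.val_injective
  let index := fun i ↦ hinternal'.subordinateOrthonormalBasisIndex rfl i hortho'
  refine ⟨hinternal'.subordinateOrthonormalBasis rfl hortho', fun i ↦ (index i).1.2,
    fun i ↦ (index i).1.1, fun i ↦ ?_⟩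
  have hmem := hinternal'.subordinateOrthonormalBasis_subordinate rfl i hortho'
  rwa [Submodule.mem_inf, Module.End.mem_eigenspace_iff, Module.End.mem_eigenspace_iff] at hmem

lemma exists_orthonormalBasis_sameRay_of_isPositive_of_commute (hS : S.IsPositive)
    (hT : T.IsPositive) (h : Commute S T) :
    ∃ b : OrthonormalBasis (Fin (Module.finrank ℝ E)) ℝ E, ∀ i, SameRay ℝ (S (b i)) (T (b i)) := by
  obtain ⟨b, s, t, hb⟩ :=
    exists_orthonormalBasis_of_isSymmetric_of_commute hS.isSymmetric hT.isSymmetric h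
  have eigenvalue_nonneg {R : E →ₗ[ℝ] E} (hR : R.IsPositive) {r : ℝ} {i} (hr : R (b i) = r • b i) :
      0 ≤ r := by
    simpa [hr, real_inner_smul_left, b.norm_eq_one] using hR.re_inner_nonneg_left (b i)
  refine ⟨b, fun i ↦ ?_⟩
  rw [(hb i).1, (hb i).2]
  exact ((SameRay.refl (b i)).nonneg_smul_left (eigenvalue_nonneg hS (hb i).1)).nonneg_smul_right
    (eigenvalue_nonneg hT (hb i).2)

end CommutingOperators

section Gaussian

lemma variance_inner_multivariateGaussian {ι : Type*} [Fintype ι] [DecidableEq ι]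
    (a e : EuclideanSpace ℝ ι) {S : Matrix ι ι ℝ} (hS : S.PosSemidef) :
    Var[fun u ↦ ⟪e, u⟫; multivariateGaussian a S] =
      ‖Matrix.toEuclideanCLM (𝕜 := ℝ) (CFC.sqrt S) e‖ ^ 2 := by
  have hsa : IsSelfAdjoint (Matrix.toEuclideanCLM (𝕜 := ℝ) (CFC.sqrt S)) :=
    (CFC.sqrt_nonneg S).isSelfAdjoint.map _
  rw [← covarianceBilin_self IsGaussian.memLp_two_id, covarianceBilin_multivariateGaussian hS,
    ← Matrix.inner_toEuclideanCLM]
  nth_rw 1 [← CFC.sqrt_mul_sqrt_self S hS.nonneg]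
  rw [map_mul, mul_apply_eq_comp, ← ContinuousLinearMap.adjoint_inner_left, hsa.adjoint_eq,
    real_inner_self_eq_norm_sq]

lemma lintegral_enorm_rpow_two_stdGaussian {E κ : Type*} [NormedAddCommGroup E]
    [InnerProductSpace ℝ E] [FiniteDimensional ℝ E] [MeasurableSpace E] [BorelSpace E] [Fintype κ]
    (b : OrthonormalBasis κ ℝ E) (c : E) (T : E →L[ℝ] E) :
    ∫⁻ z, ‖c + T z‖ₑ ^ (2 : ℝ) ∂(stdGaussian E) =
      ENNReal.ofReal (‖c‖ ^ 2 + ∑ i, ‖T (b i)‖ ^ 2) := by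
  have hT : MemLp T 2 (stdGaussian E) := IsGaussian.memLp_two_id.continuousLinearMap_comp T
  have hmean : ∫ z, c + T z ∂(stdGaussian E) = c := by
    rw [integral_add (integrable_const c) (hT.integrable one_le_two),
      T.integral_comp_id_comm IsGaussian.integrable_id, integral_id_stdGaussian]
    simp
  have hvar (i : κ) : Var[fun z ↦ ⟪b i, c + T z⟫; stdGaussian E] = ‖T.adjoint (b i)‖ ^ 2 := by
    simp_rw [inner_add_right, ← ContinuousLinearMap.adjoint_inner_left]
    rw [variance_const_add (by fun_prop), ← innerSL_apply_norm ℝ (T.adjoint (b i)),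
      ← variance_dual_stdGaussian]
    rfl
  rw [lintegral_enorm_rpow_two_eq b (Z := fun z ↦ c + T z) ((memLp_const c).add hT), hmean,
    ← sum_norm_sq_adjoint_apply b b]
  simp_rw [hvar]

variable {m : ℕ} (a b : EuclideanSpace ℝ (Fin m)) (S T : Matrix (Fin m) (Fin m) ℝ)

theorem wasserstein_multivariateGaussian_le :
    wasserstein 2 (multivariateGaussian a S) (multivariateGaussian b T) ≤
      ENNReal.ofReal √(‖a - b‖ ^ 2 + frobeniusSq (CFC.sqrt S - CFC.sqrt T)) := by
  let R := Matrix.toEuclideanCLM (𝕜 := ℝ) (CFC.sqrt S)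
  let Q := Matrix.toEuclideanCLM (𝕜 := ℝ) (CFC.sqrt T)
  have hcost : ∫⁻ z, ‖(a + R z) - (b + Q z)‖ₑ ^ (2 : ℝ) ∂(stdGaussian (EuclideanSpace ℝ (Fin m))) =
      ENNReal.ofReal (‖a - b‖ ^ 2 + frobeniusSq (CFC.sqrt S - CFC.sqrt T)) := by
    rw [frobeniusSq_eq_sum_norm_sq _ (EuclideanSpace.basisFun (Fin m) ℝ), map_sub,
      ← lintegral_enorm_rpow_two_stdGaussian]
    simp_rw [add_sub_add_comm, sub_apply, R, Q]
  rw [Real.sqrt_eq_rpow, ← ENNReal.ofReal_rpow_of_nonneg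
    (add_nonneg (sq_nonneg _) (frobeniusSq_nonneg _)) (by norm_num), ← hcost]
  exact wasserstein_two_map_map_le _ (by fun_prop) (by fun_prop)

variable {S T}

theorem wasserstein_multivariateGaussian_eq_of_commute (hS : S.PosSemidef) (hT : T.PosSemidef)
    (h : Commute S T) :
    wasserstein 2 (multivariateGaussian a S) (multivariateGaussian b T) =
      ENNReal.ofReal √(‖a - b‖ ^ 2 + frobeniusSq (CFC.sqrt S - CFC.sqrt T)) := by
  refine le_antisymm (wasserstein_multivariateGaussian_le a b S T) ?_
  let R := Matrix.toEuclideanCLM (𝕜 := ℝ) (CFC.sqrt S)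
  let Q := Matrix.toEuclideanCLM (𝕜 := ℝ) (CFC.sqrt T)
  have isPositive_sqrt (U : Matrix (Fin m) (Fin m) ℝ) : (CFC.sqrt U).toEuclideanLin.IsPositive :=
    Matrix.isPositive_toEuclideanLin_iff.2 (Matrix.nonneg_iff_posSemidef.1 (CFC.sqrt_nonneg U))
  have hsqrt : Commute (CFC.sqrt S) (CFC.sqrt T) := ((h.cfcₙ_nnreal _).symm.cfcₙ_nnreal _).symm
  have hcomm : Commute (CFC.sqrt S).toEuclideanLin (CFC.sqrt T).toEuclideanLin :=
    LinearMap.ext fun z ↦ DFunLike.congr_fun (hsqrt.map (Matrix.toEuclideanCLM (𝕜 := ℝ))).eq z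
  obtain ⟨e, he⟩ : ∃ e : OrthonormalBasis _ ℝ (EuclideanSpace ℝ (Fin m)),
      ∀ i, SameRay ℝ (R (e i)) (Q (e i)) :=
    exists_orthonormalBasis_sameRay_of_isPositive_of_commute (isPositive_sqrt S)
      (isPositive_sqrt T) hcomm
  have hfrob : frobeniusSq (CFC.sqrt S - CFC.sqrt T) = ∑ i, (‖R (e i)‖ - ‖Q (e i)‖) ^ 2 := by
    simp_rw [frobeniusSq_eq_sum_norm_sq _ e, map_sub, sub_apply]
    exact Finset.sum_congr rfl fun i _ ↦ by rw [(he i).norm_sub, sq_abs]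
  have hbound := ofReal_sqrt_le_wasserstein_two_of_memLp e
    (IsGaussian.memLp_two_id (μ := multivariateGaussian a S))
    (IsGaussian.memLp_two_id (μ := multivariateGaussian b T))
  simpa only [variance_inner_multivariateGaussian, hS, hT, Real.sqrt_sq (norm_nonneg _), id_eq,
    integral_id_multivariateGaussian, ← hfrob, R, Q] using hbound

end Gaussian

section SpectralMapping

lemma spectrum_centralizer_subset {R A : Type*} [CommRing R] [Ring A] [Algebra R A] {s : Set A}
    (x : Subalgebra.centralizer R s) : spectrum R x ⊆ spectrum R (x : A) := by
  refine fun r hr hunit ↦ hr ?_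
  obtain ⟨u, hu⟩ := hunit
  have hmem : (u : A) ∈ s.centralizer := hu ▸ (algebraMap R (Subalgebra.centralizer R s) r - x).2
  have hinv : (↑u⁻¹ : A) ∈ s.centralizer := fun y hy ↦
    (show Commute y ↑u from hmem y hy).units_inv_right
  exact ⟨⟨⟨u, hmem⟩, ⟨_, hinv⟩, Subtype.ext u.mul_inv, Subtype.ext u.inv_mul⟩, Subtype.ext hu⟩

variable {𝔸 : Type*} [NormedRing 𝔸] [NormedAlgebra ℂ 𝔸] [CompleteSpace 𝔸]

-- In the commutative case the spectrum of `b` consists of the values of the characters at `b`, and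
-- characters commute with the exponential. The general case follows by passing to the bicommutant
-- of `a`, which is commutative and closed, and in which the spectrum of `a` does not grow.
theorem spectrum_exp_subset (a : 𝔸) :
    spectrum ℂ (NormedSpace.exp a) ⊆ Complex.exp '' spectrum ℂ a := by
  let S := Subalgebra.centralizer ℂ (Set.centralizer {a})
  have hclosed : IsClosed (S : Set 𝔸) := Set.isClosed_centralizer _
  have hcomm (x y : S) : x * y = y * x :=
    Subtype.ext <|
      Set.centralizer_centralizer_comm_of_comm (S := {a}) (by simp) x x.2 y y.2
  let : NormedCommRing S := { (inferInstance : NormedRing S) with mul_comm := hcomm }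
  have : CompleteSpace S := hclosed.completeSpace_coe
  let : NormedAlgebra ℚ 𝔸 := .restrictScalars ℚ ℂ 𝔸
  let : NormedAlgebra ℚ S := .restrictScalars ℚ ℂ S
  let a' : S := ⟨a, Set.subset_centralizer_centralizer rfl⟩
  have hexp : (NormedSpace.exp a' : S) = NormedSpace.exp a :=
    NormedSpace.map_exp S.val continuous_subtype_val a'
  intro l hl
  obtain ⟨φ, rfl⟩ := WeakDual.CharacterSpace.mem_spectrum_iff_exists.1
    (spectrum.subset_subalgebra (NormedSpace.exp a' : S) (hexp.symm ▸ hl))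
  refine ⟨φ a', spectrum_centralizer_subset a' (AlgHom.apply_mem_spectrum φ a'), ?_⟩
  rw [Complex.exp_eq_exp_ℂ, NormedSpace.map_exp φ (map_continuous φ)]

end SpectralMapping

section ExponentialDecay

lemma exists_norm_le_mul_exp_of_norm_lt_one {𝔸 : Type*} [NormedRing 𝔸] {U : ℝ → 𝔸}
    (hU : Continuous U) (hadd : ∀ s t, U (s + t) = U s * U t) {T : ℝ} (hT : 0 < T)
    (hUT : ‖U T‖ < 1) :
    ∃ C c : ℝ, 0 < c ∧ ∀ t, 0 ≤ t → ‖U t‖ ≤ C * Real.exp (-c * t) := by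
  obtain ⟨c, hc, hUc⟩ : ∃ c > 0, ‖U T‖ ≤ Real.exp (-c * T) := by
    obtain ⟨q, hq, hq1⟩ := exists_between (max_lt hUT one_pos)
    obtain ⟨hUq, hq0⟩ := max_lt_iff.1 hq
    refine ⟨-Real.log q / T, div_pos (neg_pos.2 (Real.log_neg hq0 hq1)) hT, hUq.le.trans_eq ?_⟩
    rw [neg_div, neg_neg, div_mul_cancel₀ _ hT.ne', Real.exp_log hq0]
  obtain ⟨K, hK⟩ := isCompact_Icc (a := (0 : ℝ)) (b := T).exists_bound_of_continuousOn
    hU.continuousOn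
  have hmul (k : ℕ) (s : ℝ) : ‖U (k * T + s)‖ ≤ Real.exp (-c * T) ^ k * ‖U s‖ := by
    induction k with
    | zero => simp
    | succ k ih =>
      rw [Nat.cast_succ, add_one_mul, add_right_comm, add_comm _ T, hadd, pow_succ', mul_assoc]
      exact (norm_mul_le _ _).trans (by gcongr)
  refine ⟨Real.exp (c * T) * K, c, hc, fun t ht ↦ ?_⟩
  set k := ⌊t / T⌋₊
  have hkt : k * T ≤ t := (le_div_iff₀ hT).1 (Nat.floor_le (by positivity))
  have htk : t < (k + 1) * T := (div_lt_iff₀ hT).1 (Nat.lt_floor_add_one _)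
  have hKk : ‖U (t - k * T)‖ ≤ K := hK _ ⟨by linarith, by linarith⟩
  have hK0 : 0 ≤ K := (norm_nonneg _).trans hKk
  calc ‖U t‖ = ‖U (k * T + (t - k * T))‖ := by rw [add_sub_cancel]
    _ ≤ Real.exp (-c * T) ^ k * K := (hmul _ _).trans (by gcongr)
    _ ≤ Real.exp (c * T + -c * t) * K := by
      rw [← Real.exp_nat_mul]
      gcongr
      nlinarith
    _ = Real.exp (c * T) * K * Real.exp (-c * t) := by rw [Real.exp_add, mul_right_comm]

variable {𝔸 : Type*} [NormedRing 𝔸] [NormedAlgebra ℂ 𝔸] [CompleteSpace 𝔸] {a : 𝔸}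

lemma spectralRadius_exp_lt_one (ha : ∀ z ∈ spectrum ℂ a, z.re < 0) :
    spectralRadius ℂ (NormedSpace.exp a) < 1 := by
  rcases (spectrum ℂ (NormedSpace.exp a)).eq_empty_or_nonempty with h | h
  · simp [spectralRadius, h]
  · refine spectrum.spectralRadius_lt_of_forall_lt_of_nonempty h fun l hl ↦ ?_
    obtain ⟨z, hz, rfl⟩ := spectrum_exp_subset a hl
    rw [← NNReal.coe_lt_coe, coe_nnnorm, Complex.norm_exp]
    exact Real.exp_lt_one_iff.2 (ha z hz)

lemma exists_norm_pow_lt_one_of_spectralRadius_lt_one (ha : spectralRadius ℂ a < 1) :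
    ∃ n : ℕ, 0 < n ∧ ‖a ^ n‖ < 1 := by
  have h := (spectrum.pow_nnnorm_pow_one_div_tendsto_nhds_spectralRadius a).eventually_lt_const ha
  obtain ⟨n, hn, hn0⟩ := (h.and (eventually_gt_atTop 0)).exists
  refine ⟨n, hn0, ?_⟩
  contrapose! hn
  exact ENNReal.one_le_rpow (by exact_mod_cast hn) (by positivity)

theorem exists_norm_exp_smul_le_of_spectrum_re_neg (ha : ∀ z ∈ spectrum ℂ a, z.re < 0) :
    ∃ C c : ℝ, 0 < c ∧ ∀ t : ℝ, 0 ≤ t →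
      ‖NormedSpace.exp ((t : ℂ) • a)‖ ≤ C * Real.exp (-c * t) := by
  let : NormedAlgebra ℚ 𝔸 := .restrictScalars ℚ ℂ 𝔸
  obtain ⟨n, hn, hlt⟩ :=
    exists_norm_pow_lt_one_of_spectralRadius_lt_one (spectralRadius_exp_lt_one ha)
  refine exists_norm_le_mul_exp_of_norm_lt_one (T := n) ?_ (fun s t ↦ ?_) (by exact_mod_cast hn) ?_
  · exact NormedSpace.exp_continuous.comp (by fun_prop)
  · rw [Complex.ofReal_add, add_smul, NormedSpace.exp_add_of_commute]
    exact ((Commute.refl a).smul_left _).smul_right _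
  · rwa [Complex.ofReal_natCast, Nat.cast_smul_eq_nsmul, NormedSpace.exp_nsmul]

end ExponentialDecay

section MatrixExponential

open scoped Matrix.Norms.Frobenius

variable {m n : ℕ} (A : Matrix (Fin m) (Fin m) ℝ)

lemma expNeg_transpose (t : ℝ) : expNeg Aᵀ t = (expNeg A t)ᵀ := by
  rw [expNeg, expNeg, ← Matrix.exp_transpose, Matrix.transpose_smul]

lemma continuous_expNeg : Continuous (expNeg A) :=
  NormedSpace.exp_continuous.comp (by fun_prop)

lemma map_ofReal_expNeg (t : ℝ) : (expNeg A t).map (algebraMap ℝ ℂ) =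
    NormedSpace.exp ((t : ℂ) • -A.map (algebraMap ℝ ℂ)) := by
  have hcont : Continuous ((algebraMap ℝ ℂ).mapMatrix (m := Fin m)) :=
    continuous_id.matrix_map Complex.continuous_ofReal
  have hmap : (algebraMap ℝ ℂ).mapMatrix (-t • A) = (t : ℂ) • -A.map (algebraMap ℝ ℂ) := by
    ext i j
    simp
  rw [← hmap]
  exact NormedSpace.map_exp (algebraMap ℝ ℂ).mapMatrix hcont (-t • A)

variable {A}

lemma norm_apply_le_frobenius_norm (M : Matrix (Fin m) (Fin m) ℝ) (i j : Fin m) :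
    ‖M i j‖ ≤ ‖M‖ :=
  (PiLp.norm_apply_le (WithLp.toLp 2 (M i)) j).trans
    (PiLp.norm_apply_le (WithLp.toLp 2 fun i ↦ WithLp.toLp 2 (M i)) i)

lemma exists_norm_expNeg_le (hA : HasPositiveSpectrum A) :
    ∃ C c : ℝ, 0 < c ∧ ∀ t : ℝ, 0 ≤ t → ‖expNeg A t‖ ≤ C * Real.exp (-c * t) := by
  have hneg : ∀ z ∈ spectrum ℂ (-A.map (algebraMap ℝ ℂ)), z.re < 0 := fun z hz ↦
    neg_pos.1 (hA (-z) (by rwa [← Set.mem_neg, spectrum.neg_eq]))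
  obtain ⟨C, c, hc, h⟩ := exists_norm_exp_smul_le_of_spectrum_re_neg hneg
  refine ⟨C, c, hc, fun t ht ↦ ?_⟩
  rw [← Matrix.frobenius_norm_map_eq (expNeg A t) (algebraMap ℝ ℂ) Complex.norm_real,
    map_ofReal_expNeg]
  exact h t ht

lemma tendsto_expNeg (hA : HasPositiveSpectrum A) : Tendsto (expNeg A) atTop (𝓝 0) := by
  obtain ⟨C, c, hc, h⟩ := exists_norm_expNeg_le hA
  refine squeeze_zero_norm' (eventually_atTop.2 ⟨0, h⟩) ?_
  have hlin : Tendsto (fun t : ℝ ↦ -c * t) atTop atBot :=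
    tendsto_id.const_mul_atTop_of_neg (neg_lt_zero.2 hc)
  simpa only [mul_zero, Function.comp_def] using (Real.tendsto_exp_atBot.comp hlin).const_mul C

variable (A) (σ : Matrix (Fin m) (Fin n) ℝ)

/-- The integrand `e^{-As} σ σ* e^{-A*s}` of the covariance matrices `covAt` and `covInfty`. -/
noncomputable def covDensity (s : ℝ) : Matrix (Fin m) (Fin m) ℝ :=
  expNeg A s * σ * σᵀ * expNeg Aᵀ s

lemma covDensity_eq_mul_transpose (s : ℝ) :
    covDensity A σ s = (expNeg A s * σ) * (expNeg A s * σ)ᵀ := by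
  rw [covDensity, Matrix.transpose_mul, expNeg_transpose, Matrix.mul_assoc _ σᵀ]

lemma posSemidef_covDensity (s : ℝ) : (covDensity A σ s).PosSemidef := by
  rw [covDensity_eq_mul_transpose]
  exact Matrix.posSemidef_self_mul_conjTranspose _

lemma continuous_covDensity : Continuous (covDensity A σ) :=
  (((continuous_expNeg A).matrix_mul continuous_const).matrix_mul continuous_const).matrix_mul
    (continuous_expNeg Aᵀ)

variable {A}

lemma exists_norm_covDensity_le (hA : HasPositiveSpectrum A) :
    ∃ K c : ℝ, 0 < c ∧ ∀ s : ℝ, 0 ≤ s → ‖covDensity A σ s‖ ≤ K * Real.exp (-c * s) := by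
  obtain ⟨C, c, hc, h⟩ := exists_norm_expNeg_le hA
  refine ⟨(C * ‖σ‖) ^ 2, 2 * c, by positivity, fun s hs ↦ ?_⟩
  have hroot : ‖expNeg A s * σ‖ ≤ C * Real.exp (-c * s) * ‖σ‖ :=
    (Matrix.frobenius_norm_mul _ _).trans (by gcongr; exact h s hs)
  calc ‖covDensity A σ s‖ ≤ ‖expNeg A s * σ‖ ^ 2 := by
        rw [covDensity_eq_mul_transpose, sq]
        exact (Matrix.frobenius_norm_mul _ _).trans_eq (by rw [Matrix.frobenius_norm_transpose])
    _ ≤ (C * Real.exp (-c * s) * ‖σ‖) ^ 2 := by gcongr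
    _ = (C * ‖σ‖) ^ 2 * Real.exp (-(2 * c) * s) := by
        rw [mul_right_comm, mul_pow, ← Real.exp_nat_mul]
        push_cast
        ring_nf

lemma integrableOn_Ioi_covDensity_apply (hA : HasPositiveSpectrum A) (i j : Fin m) :
    IntegrableOn (fun s ↦ covDensity A σ s i j) (Set.Ioi 0) := by
  obtain ⟨K, c, hc, h⟩ := exists_norm_covDensity_le σ hA
  exact ((exp_neg_integrableOn_Ioi 0 hc).const_mul K).mono'
    ((continuous_covDensity A σ).matrix_elem i j).aestronglyMeasurable
    ((ae_restrict_iff' measurableSet_Ioi).2 (ae_of_all _ fun s hs ↦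
      (norm_apply_le_frobenius_norm _ i j).trans (h s (Set.mem_Ioi.1 hs).le)))

end MatrixExponential

section Covariance

section IntegralOfMatrices

variable {α ι : Type*} [MeasurableSpace α] {ν : Measure α} {M : α → Matrix ι ι ℝ}

lemma dotProduct_of_integral_mulVec [Fintype ι] (hM : ∀ i j, Integrable (fun s ↦ M s i j) ν)
    (v : ι → ℝ) :
    v ⬝ᵥ (Matrix.of fun i j ↦ ∫ s, M s i j ∂ν) *ᵥ v = ∫ s, v ⬝ᵥ M s *ᵥ v ∂ν := by
  have hterm (i j : ι) : Integrable (fun s ↦ v i * (M s i j * v j)) ν :=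
    ((hM i j).mul_const _).const_mul _
  simp only [dotProduct, Matrix.mulVec, Matrix.of_apply, Finset.mul_sum]
  rw [integral_finsetSum _ fun i _ ↦ integrable_finsetSum _ fun j _ ↦ hterm i j]
  simp_rw [integral_finsetSum _ fun j _ ↦ hterm _ j, integral_const_mul, integral_mul_const]

lemma posSemidef_of_integral [Finite ι] (hM : ∀ i j, Integrable (fun s ↦ M s i j) ν)
    (hp : ∀ s, (M s).PosSemidef) : (Matrix.of fun i j ↦ ∫ s, M s i j ∂ν).PosSemidef := by
  have := Fintype.ofFinite ι
  refine .of_dotProduct_mulVec_nonneg ?_ fun v ↦ ?_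
  · ext i j
    exact integral_congr_ae (ae_of_all _ fun s ↦ (hp s).isHermitian.apply i j)
  · rw [star_trivial, dotProduct_of_integral_mulVec hM]
    exact integral_nonneg fun s ↦ (hp s).dotProduct_mulVec_nonneg v

end IntegralOfMatrices

variable {m n : ℕ} (A : Matrix (Fin m) (Fin m) ℝ) (σ : Matrix (Fin m) (Fin n) ℝ)

lemma dotProduct_covDensity_mulVec (s : ℝ) (v : EuclideanSpace ℝ (Fin m)) :
    v ⬝ᵥ covDensity A σ s *ᵥ v = ‖(expNeg A s * σ)ᵀ.toEuclideanLin v‖ ^ 2 := by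
  rw [covDensity_eq_mul_transpose, ← Matrix.mulVec_mulVec, Matrix.dotProduct_mulVec,
    ← Matrix.mulVec_transpose, EuclideanSpace.real_norm_sq_eq]
  simp only [dotProduct, sq, Matrix.ofLp_toLpLin, Matrix.toLin'_apply]

lemma integrableOn_Ioc_covDensity_apply (t : ℝ) (i j : Fin m) :
    IntegrableOn (fun s ↦ covDensity A σ s i j) (Set.Ioc 0 t) :=
  ((continuous_covDensity A σ).matrix_elem i j).integrableOn_Ioc

lemma covAt_eq_setIntegral {t : ℝ} (ht : 0 ≤ t) :
    covAt A σ t = Matrix.of fun i j ↦ ∫ s in Set.Ioc 0 t, covDensity A σ s i j := by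
  simp only [covAt, covDensity, intervalIntegral.integral_of_le ht]

lemma posSemidef_covAt {t : ℝ} (ht : 0 ≤ t) : (covAt A σ t).PosSemidef := by
  rw [covAt_eq_setIntegral A σ ht]
  exact posSemidef_of_integral (integrableOn_Ioc_covDensity_apply A σ t)
    (posSemidef_covDensity A σ)

lemma dotProduct_covAt_mulVec {t : ℝ} (ht : 0 ≤ t) (v : EuclideanSpace ℝ (Fin m)) :
    v ⬝ᵥ covAt A σ t *ᵥ v = ∫ s in (0 : ℝ)..t, ‖(expNeg A s * σ)ᵀ.toEuclideanLin v‖ ^ 2 := by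
  rw [covAt_eq_setIntegral A σ ht, intervalIntegral.integral_of_le ht,
    dotProduct_of_integral_mulVec (integrableOn_Ioc_covDensity_apply A σ t)]
  simp_rw [dotProduct_covDensity_mulVec]

variable {A}

lemma posSemidef_covInfty (hA : HasPositiveSpectrum A) : (covInfty A σ).PosSemidef :=
  posSemidef_of_integral (integrableOn_Ioi_covDensity_apply σ hA) (posSemidef_covDensity A σ)

lemma tendsto_covAt (hA : HasPositiveSpectrum A) :
    Tendsto (covAt A σ) atTop (𝓝 (covInfty A σ)) :=
  tendsto_pi_nhds.2 fun i ↦ tendsto_pi_nhds.2 fun j ↦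
    intervalIntegral_tendsto_integral_Ioi 0 (integrableOn_Ioi_covDensity_apply σ hA i j) tendsto_id

end Covariance

section UniformPartition

/-- The `k`-th point of the partition of `[0, t]` into `N` cells of equal length. -/
noncomputable def partitionPoint (t : ℝ≥0) (N k : ℕ) : ℝ≥0 := k * (t / N)

variable (t : ℝ≥0) (N k : ℕ)

lemma partitionPoint_zero : partitionPoint t N 0 = 0 := by simp [partitionPoint]

lemma partitionPoint_self (hN : N ≠ 0) : partitionPoint t N N = t :=
  mul_div_cancel₀ t (Nat.cast_ne_zero.2 hN)

lemma monotone_partitionPoint : Monotone (partitionPoint t N) := fun i j hij ↦ by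
  unfold partitionPoint
  gcongr

lemma partitionPoint_succ_sub :
    (partitionPoint t N (k + 1) : ℝ) - partitionPoint t N k = t / N := by
  simp only [partitionPoint]
  push_cast
  ring

variable {N k} in
lemma partitionPoint_le (hk : k ≤ N) : partitionPoint t N k ≤ t := by
  rcases eq_or_ne N 0 with rfl | hN
  · simp [partitionPoint]
  · exact (monotone_partitionPoint t N hk).trans_eq (partitionPoint_self t N hN)

variable {t N k} in
lemma mem_Icc_of_mem_cell (hk : k < N) {s : ℝ}
    (hs : s ∈ Set.Icc (partitionPoint t N k : ℝ) (partitionPoint t N (k + 1))) :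
    s ∈ Set.Icc (0 : ℝ) t :=
  ⟨(partitionPoint t N k).coe_nonneg.trans hs.1,
    hs.2.trans (NNReal.coe_le_coe.2 (partitionPoint_le t hk))⟩

variable {H : Type*} [NormedAddCommGroup H]

lemma eventually_norm_sub_le_of_mem_cell {G : ℝ → ℝ → H}
    (hG : Continuous (Function.uncurry G)) {ε : ℝ} (hε : 0 < ε) :
    ∀ᶠ N : ℕ in atTop, ∀ k < N,
      ∀ s ∈ Set.Icc (partitionPoint t N k : ℝ) (partitionPoint t N (k + 1)),
        ‖G s (partitionPoint t N (k + 1)) - G (partitionPoint t N k) s‖ ≤ ε := by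
  have hunif := (isCompact_Icc.prod isCompact_Icc).uniformContinuousOn_of_continuous
    (hG.continuousOn (s := Set.Icc (0 : ℝ) t ×ˢ Set.Icc (0 : ℝ) t))
  obtain ⟨δ, hδ, hclose⟩ := Metric.uniformContinuousOn_iff.1 hunif ε hε
  filter_upwards [(tendsto_const_div_atTop_nhds_zero_nat (t : ℝ)).eventually_lt_const hδ]
    with N hN k hk s hs
  have hle : (partitionPoint t N k : ℝ) ≤ partitionPoint t N (k + 1) :=
    monotone_partitionPoint t N k.le_succ
  have hleft := mem_Icc_of_mem_cell hk (Set.left_mem_Icc.2 hle)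
  have hright := mem_Icc_of_mem_cell hk (Set.right_mem_Icc.2 hle)
  have hmid := mem_Icc_of_mem_cell hk hs
  rw [← partitionPoint_succ_sub t N k] at hN
  rw [← dist_eq_norm]
  exact (hclose (s, _) ⟨hmid, hright⟩ (_, s) ⟨hleft, hmid⟩ (max_lt
    ((Real.dist_le_of_mem_Icc hs (Set.left_mem_Icc.2 hle)).trans_lt hN)
    ((Real.dist_le_of_mem_Icc (Set.right_mem_Icc.2 hle) hs).trans_lt hN))).le

variable [NormedSpace ℝ H]

lemma norm_sum_integral_cell_le {C : ℝ} (hC : 0 ≤ C) {f : ℕ → ℝ → H}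
    (hf : ∀ k < N, ∀ s ∈ Set.Icc (partitionPoint t N k : ℝ) (partitionPoint t N (k + 1)),
      ‖f k s‖ ≤ C) :
    ‖∑ k ∈ Finset.range N, ∫ s in partitionPoint t N k..partitionPoint t N (k + 1), f k s‖ ≤
      C * t := by
  have hcell (k : ℕ) (hk : k ∈ Finset.range N) :
      ‖∫ s in partitionPoint t N k..partitionPoint t N (k + 1), f k s‖ ≤ C * (t / N) := by
    have hle : (partitionPoint t N k : ℝ) ≤ partitionPoint t N (k + 1) :=
      monotone_partitionPoint t N k.le_succ
    rw [← partitionPoint_succ_sub t N k, ← abs_of_nonneg (sub_nonneg.2 hle)]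
    refine intervalIntegral.norm_integral_le_of_norm_le_const fun s hs ↦ ?_
    rw [Set.uIoc_of_le hle] at hs
    exact hf k (Finset.mem_range.1 hk) s (Set.Ioc_subset_Icc_self hs)
  calc _ ≤ ∑ _k ∈ Finset.range N, C * (t / N) := norm_sum_le_of_le _ hcell
    _ = C * partitionPoint t N N := by
        rw [Finset.sum_const, Finset.card_range, nsmul_eq_mul, partitionPoint]
        push_cast
        ring
    _ ≤ C * t := by
        gcongr
        exact partitionPoint_le t le_rfl

lemma tendsto_sum_integral_cell {G : ℝ → ℝ → H} (hG : Continuous (Function.uncurry G)) :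
    Tendsto (fun N : ℕ ↦ ∑ k ∈ Finset.range N,
      ∫ s in partitionPoint t N k..partitionPoint t N (k + 1),
        (G s (partitionPoint t N (k + 1)) - G (partitionPoint t N k) s)) atTop (𝓝 0) := by
  refine Metric.tendsto_nhds.2 fun ε hε ↦ ?_
  filter_upwards [eventually_norm_sub_le_of_mem_cell t hG (ε := ε / (t + 1)) (by positivity)]
    with N hN
  rw [dist_zero_right]
  calc _ ≤ ε / (t + 1) * t := norm_sum_integral_cell_le t N (by positivity) hN
    _ < ε := by
        rw [div_mul_eq_mul_div, div_lt_iff₀ (by positivity)]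
        nlinarith

lemma tendsto_riemannSum [CompleteSpace H] {f : ℝ → H} (hf : Continuous f) :
    Tendsto (fun N : ℕ ↦ ∑ k ∈ Finset.range N, ((t : ℝ) / N) • f (partitionPoint t N k)) atTop
      (𝓝 (∫ s in (0 : ℝ)..t, f s)) := by
  have herror := tendsto_sum_integral_cell t (G := fun s _ ↦ f s) (by fun_prop)
  have hlim := herror.const_sub (∫ s in (0 : ℝ)..t, f s)
  rw [sub_zero] at hlim
  refine hlim.congr' ?_
  filter_upwards [eventually_ne_atTop 0] with N hN
  have hsum := intervalIntegral.sum_integral_adjacent_intervals (f := f) (μ := volume) (n := N)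
    (a := fun k : ℕ ↦ (partitionPoint t N k : ℝ)) fun k _ ↦ hf.intervalIntegrable _ _
  rw [partitionPoint_zero, partitionPoint_self t N hN, NNReal.coe_zero] at hsum
  rw [← hsum, ← Finset.sum_sub_distrib]
  refine Finset.sum_congr rfl fun k _ ↦ ?_
  rw [intervalIntegral.integral_sub (hf.intervalIntegrable _ _) (by simp),
    intervalIntegral.integral_const, partitionPoint_succ_sub, sub_sub_cancel]

end UniformPartition

section VariationOfConstants

variable {E H : Type*} [NormedAddCommGroup E] [NormedSpace ℝ E]
  [NormedAddCommGroup H] [NormedSpace ℝ H]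

/-- The Riemann–Stieltjes sum of `∫₀ᵗ F dw` over the partition of `[0, t]` into `N` cells of equal
length, with `F` evaluated at the left end of each cell. -/
noncomputable def stieltjesSum (F : ℝ → E →L[ℝ] H) (w : ℝ≥0 → E) (t : ℝ≥0) (N : ℕ) : H :=
  ∑ k ∈ Finset.range N,
    F (partitionPoint t N k) (w (partitionPoint t N (k + 1)) - w (partitionPoint t N k))

variable [CompleteSpace E]

lemma hasDerivAt_exp_sub_smul (L : E →L[ℝ] E) (t s : ℝ) :
    HasDerivAt (fun s : ℝ ↦ NormedSpace.exp ((s - t) • L))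
      (NormedSpace.exp ((s - t) • L) * L) s :=
  (hasDerivAt_exp_smul_const L (s - t)).comp_sub_const s t

lemma continuous_exp_sub_smul (L : E →L[ℝ] E) (t : ℝ) :
    Continuous fun s : ℝ ↦ NormedSpace.exp ((s - t) • L) :=
  continuous_iff_continuousAt.2 fun s ↦ (hasDerivAt_exp_sub_smul L t s).continuousAt

variable {L : E →L[ℝ] E} {x : E} {Y W : ℝ≥0 → E} (hY : Continuous Y)
  (heq : ∀ t, Y t = x - (∫ s in (0 : ℝ)..t, L (Y s.toNNReal)) + W t)
include hY heq

-- The increment of `W` over `[a, b]` is `Y b - Y a + ∫ L (Y s)`, and the factor `L` of the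
-- remaining terms comes out of the derivative of the exponential.
lemma exp_increment_sub_exp_apply_increment (t : ℝ) (a b : ℝ≥0) :
    NormedSpace.exp ((b - t) • L) (Y b) - NormedSpace.exp ((a - t) • L) (Y a) -
        NormedSpace.exp ((a - t) • L) (W b - W a) =
      ∫ s in a..b, (NormedSpace.exp ((s - t) • L) (L (Y b)) -
        NormedSpace.exp ((a - t) • L) (L (Y s.toNNReal))) := by
  have hLY : Continuous fun s : ℝ ↦ L (Y s.toNNReal) := by fun_prop
  have hexp : Continuous fun s : ℝ ↦ NormedSpace.exp ((s - t) • L) (L (Y b)) :=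
    (continuous_exp_sub_smul L t).clm_apply continuous_const
  have hconst : Continuous fun s : ℝ ↦ NormedSpace.exp ((a - t) • L) (L (Y s.toNNReal)) := by
    fun_prop
  have hkernel : ∫ s in a..b, NormedSpace.exp ((s - t) • L) (L (Y b)) =
      NormedSpace.exp ((b - t) • L) (Y b) - NormedSpace.exp ((a - t) • L) (Y b) :=
    intervalIntegral.integral_eq_sub_of_hasDerivAt (fun s _ ↦
      (ContinuousLinearMap.apply ℝ E (Y b)).hasFDerivAt.comp_hasDerivAt s
        (hasDerivAt_exp_sub_smul L t s)) (hexp.intervalIntegrable _ _)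
  have hincrement : W b - W a = Y b - Y a + ∫ s in a..b, L (Y s.toNNReal) := by
    rw [heq b, heq a, ← intervalIntegral.integral_interval_sub_left
      (hLY.intervalIntegrable 0 b) (hLY.intervalIntegrable 0 a)]
    abel
  have hpull : ∫ s in a..b, NormedSpace.exp ((a - t) • L) (L (Y s.toNNReal)) =
      NormedSpace.exp ((a - t) • L) (∫ s in a..b, L (Y s.toNNReal)) :=
    ContinuousLinearMap.intervalIntegral_comp_comm _ (hLY.intervalIntegrable _ _)
  rw [intervalIntegral.integral_sub (hexp.intervalIntegrable _ _)
    (hconst.intervalIntegrable _ _), hkernel, hpull, hincrement, map_add, map_sub]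
  abel

theorem tendsto_stieltjesSum_exp (t : ℝ≥0) :
    Tendsto (stieltjesSum (fun s ↦ NormedSpace.exp ((s - t) • L)) W t) atTop
      (𝓝 (Y t - NormedSpace.exp (-(t : ℝ) • L) (Y 0))) := by
  have hcont : Continuous (Function.uncurry fun s r : ℝ ↦
      NormedSpace.exp ((s - t) • L) (L (Y r.toNNReal))) :=
    ((continuous_exp_sub_smul L t).comp continuous_fst).clm_apply (by fun_prop)
  have hlim := (tendsto_sum_integral_cell t hcont).const_sub
    (Y t - NormedSpace.exp (-(t : ℝ) • L) (Y 0))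
  rw [sub_zero] at hlim
  refine hlim.congr' ?_
  filter_upwards [eventually_ne_atTop 0] with N hN
  have htelescope := Finset.sum_range_sub (fun k : ℕ ↦
    NormedSpace.exp ((partitionPoint t N k - (t : ℝ)) • L) (Y (partitionPoint t N k))) N
  simp only [partitionPoint_zero, partitionPoint_self t N hN, sub_self, zero_smul,
    NormedSpace.exp_zero, NNReal.coe_zero, zero_sub, one_apply_eq_self] at htelescope
  rw [← htelescope, stieltjesSum, ← Finset.sum_sub_distrib]
  refine Finset.sum_congr rfl fun k _ ↦ ?_
  simp only [Real.toNNReal_coe]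
  rw [← exp_increment_sub_exp_apply_increment hY heq, sub_sub_cancel]

end VariationOfConstants

section WienerIntegral

variable {Ω : Type*} [MeasurableSpace Ω] {P : Measure Ω}

lemma map_increment_of_isBrownianReal {b : ℝ≥0 → Ω → ℝ} (hb : IsBrownianReal b P) {s t : ℝ≥0}
    (hst : s ≤ t) : P.map (fun ω ↦ b t ω - b s ω) = gaussianReal 0 (t - s) := by
  have hdist : nndist t s = t - s := by
    rw [NNReal.nndist_eq, tsub_eq_zero_of_le hst, max_eq_left zero_le]
  rw [← hdist]
  exact (hb.hasLaw_sub t s).map_eq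

lemma charFun_map_sum_mul_increment {b : ℝ≥0 → Ω → ℝ} (hb : IsBrownianReal b P) {τ : ℕ → ℝ≥0}
    (hτ : Monotone τ) (c : ℕ → ℝ) (N : ℕ) :
    charFun (P.map fun ω ↦ ∑ k ∈ Finset.range N, c k * (b (τ (k + 1)) ω - b (τ k) ω)) 1 =
      Complex.exp (-((∑ k ∈ Finset.range N, ((τ (k + 1) : ℝ) - τ k) * c k ^ 2 : ℝ) : ℂ) / 2) := by
  have hm (k : ℕ) : AEMeasurable (fun ω ↦ b (τ (k + 1)) ω - b (τ k) ω) P :=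
    (hb.aemeasurable _).sub (hb.aemeasurable _)
  have hind := (hb.hasIndepIncrements.nat hτ).comp (fun k y ↦ c k * y) (fun k ↦ by fun_prop)
  rw [iIndepFun.charFun_map_fun_finsetSum_eq_prod
    (X := fun k ω ↦ c k * (b (τ (k + 1)) ω - b (τ k) ω)) (fun k _ ↦ (hm k).const_mul _)
    (hind.restrict _), Finset.prod_apply, Complex.ofReal_sum, ← Finset.sum_neg_distrib,
    Finset.sum_div, Complex.exp_sum]
  refine Finset.prod_congr rfl fun k _ ↦ ?_
  rw [charFun_map_mul_comp (f := fun ω ↦ b (τ (k + 1)) ω - b (τ k) ω) (hm k),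
    map_increment_of_isBrownianReal hb (hτ k.le_succ), charFun_gaussianReal,
    NNReal.coe_sub (hτ k.le_succ)]
  congr 1
  push_cast
  ring

variable {n : ℕ} {B : ℝ≥0 → Ω → EuclideanSpace ℝ (Fin n)}

namespace IsStdBrownian

lemma aemeasurable (hB : IsStdBrownian B P) (t : ℝ≥0) : AEMeasurable (B t) P :=
  (MeasurableEquiv.toLp 2 (Fin n → ℝ)).measurable.comp_aemeasurable
    (aemeasurable_pi_lambda (fun ω i ↦ B t ω i) fun i ↦ (hB.coord i).aemeasurable t)

lemma ae_eval_zero (hB : IsStdBrownian B P) : ∀ᵐ ω ∂P, B 0 ω = 0 := by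
  filter_upwards [ae_all_iff.2 fun i ↦ (hB.coord i).eval_zero_ae_eq_zero] with ω hω
  ext i
  exact hω i

lemma aemeasurable_stieltjesSum {H : Type*} [NormedAddCommGroup H] [NormedSpace ℝ H]
    [MeasurableSpace H] [BorelSpace H] [SecondCountableTopology H] (hB : IsStdBrownian B P)
    (F : ℝ → EuclideanSpace ℝ (Fin n) →L[ℝ] H) (t : ℝ≥0) (N : ℕ) :
    AEMeasurable (fun ω ↦ stieltjesSum F (B · ω) t N) P :=
  Finset.aemeasurable_fun_sum _ fun k _ ↦
    (F (partitionPoint t N k)).continuous.measurable.comp_aemeasurable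
      ((hB.aemeasurable _).sub (hB.aemeasurable _))

lemma charFun_map_sum_inner_increment (hB : IsStdBrownian B P) {τ : ℕ → ℝ≥0} (hτ : Monotone τ)
    (g : ℕ → EuclideanSpace ℝ (Fin n)) (N : ℕ) :
    charFun (P.map fun ω ↦ ∑ k ∈ Finset.range N, ⟪g k, B (τ (k + 1)) ω - B (τ k) ω⟫) 1 =
      Complex.exp
        (-((∑ k ∈ Finset.range N, ((τ (k + 1) : ℝ) - τ k) * ‖g k‖ ^ 2 : ℝ) : ℂ) / 2) := by
  let S (i : Fin n) (ω : Ω) : ℝ :=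
    ∑ k ∈ Finset.range N, g k i * (B (τ (k + 1)) ω i - B (τ k) ω i)
  have hS (i : Fin n) : AEMeasurable (S i) P :=
    Finset.aemeasurable_fun_sum _ fun k _ ↦ (((hB.coord i).aemeasurable _).sub
      ((hB.coord i).aemeasurable _)).const_mul _
  have hind : iIndepFun S P := hB.indep.comp
    (fun i w ↦ ∑ k ∈ Finset.range N, g k i * (w (τ (k + 1)) - w (τ k))) (fun i ↦ by fun_prop)
  have hsum (ω : Ω) : ∑ k ∈ Finset.range N, ⟪g k, B (τ (k + 1)) ω - B (τ k) ω⟫ = ∑ i, S i ω := by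
    rw [Finset.sum_comm]
    simp [PiLp.inner_apply, mul_comm]
  simp_rw [hsum]
  rw [hind.charFun_map_fun_sum_eq_prod hS, Finset.prod_apply]
  simp_rw [S, charFun_map_sum_mul_increment (hB.coord _) hτ]
  rw [← Complex.exp_sum, ← Finset.sum_div, Finset.sum_neg_distrib, ← Complex.ofReal_sum,
    Finset.sum_comm]
  simp_rw [EuclideanSpace.real_norm_sq_eq, Finset.mul_sum]

lemma charFun_map_stieltjesSum_innerSL (hB : IsStdBrownian B P)
    (g : ℝ → EuclideanSpace ℝ (Fin n)) (t : ℝ≥0) (N : ℕ) :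
    charFun (P.map fun ω ↦ stieltjesSum (fun s ↦ innerSL ℝ (g s)) (B · ω) t N) 1 =
      Complex.exp (-((∑ k ∈ Finset.range N, ((t : ℝ) / N) • ‖g (partitionPoint t N k)‖ ^ 2 : ℝ) :
        ℂ) / 2) := by
  have h := hB.charFun_map_sum_inner_increment (monotone_partitionPoint t N)
    (fun k ↦ g (partitionPoint t N k)) N
  simp_rw [partitionPoint_succ_sub] at h
  exact h

theorem integral_exp_of_ae_tendsto_stieltjesSum [IsProbabilityMeasure P]
    (hB : IsStdBrownian B P) {g : ℝ → EuclideanSpace ℝ (Fin n)} (hg : Continuous g) {t : ℝ≥0}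
    {Z : Ω → ℝ}
    (hZ : ∀ᵐ ω ∂P, Tendsto (stieltjesSum (fun s ↦ innerSL ℝ (g s)) (B · ω) t) atTop (𝓝 (Z ω))) :
    ∫ ω, Complex.exp (Z ω * Complex.I) ∂P =
      Complex.exp (-((∫ s in (0 : ℝ)..t, ‖g s‖ ^ 2 : ℝ) : ℂ) / 2) := by
  let R (N : ℕ) (ω : Ω) : ℝ := stieltjesSum (fun s ↦ innerSL ℝ (g s)) (B · ω) t N
  have hR (N : ℕ) : AEMeasurable (R N) P := hB.aemeasurable_stieltjesSum _ t N
  have hexp : Continuous fun r : ℝ ↦ Complex.exp (r * Complex.I) := by fun_prop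
  have hchar (N : ℕ) : charFun (P.map (R N)) 1 = ∫ ω, Complex.exp (R N ω * Complex.I) ∂P := by
    simp only [charFun_apply_real, Complex.ofReal_one, one_mul]
    exact integral_map (hR N) hexp.aestronglyMeasurable
  have hleft : Tendsto (fun N ↦ charFun (P.map (R N)) 1) atTop
      (𝓝 (∫ ω, Complex.exp (Z ω * Complex.I) ∂P)) := by
    simp_rw [hchar]
    refine tendsto_integral_of_dominated_convergence (fun _ ↦ 1)
      (fun N ↦ (hexp.measurable.comp_aemeasurable (hR N)).aestronglyMeasurable)
      (integrable_const _) (fun N ↦ ae_of_all _ fun ω ↦ (Complex.norm_exp_ofReal_mul_I _).le) ?_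
    filter_upwards [hZ] with ω hω
    exact (hexp.tendsto _).comp hω
  have hright : Tendsto (fun N ↦ charFun (P.map (R N)) 1) atTop
      (𝓝 (Complex.exp (-((∫ s in (0 : ℝ)..t, ‖g s‖ ^ 2 : ℝ) : ℂ) / 2))) := by
    simp_rw [R, hB.charFun_map_stieltjesSum_innerSL]
    exact ((by fun_prop : Continuous fun r : ℝ ↦ Complex.exp (-(r : ℂ) / 2)).tendsto _).comp
      (tendsto_riemannSum t (hg.norm.pow 2))
  exact tendsto_nhds_unique hleft hright

end IsStdBrownian

end WienerIntegral

section OrnsteinUhlenbeckLaw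

lemma inner_toEuclideanLin {ι κ : Type*} [Fintype ι] [DecidableEq ι] [Fintype κ] [DecidableEq κ]
    (M : Matrix ι κ ℝ) (v : EuclideanSpace ℝ ι) (w : EuclideanSpace ℝ κ) :
    ⟪v, M.toEuclideanLin w⟫ = ⟪Mᵀ.toEuclideanLin v, w⟫ := by
  rw [← Matrix.conjTranspose_eq_transpose_of_trivial,
    Matrix.toEuclideanLin_conjTranspose_eq_adjoint, LinearMap.adjoint_inner_left]

lemma continuous_toEuclideanLin_apply {ι κ : Type*} [Fintype κ] [DecidableEq κ]
    (v : EuclideanSpace ℝ κ) : Continuous fun M : Matrix ι κ ℝ ↦ M.toEuclideanLin v := by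
  simp_rw [Matrix.toLpLin_apply]
  fun_prop

variable {m n : ℕ}

open scoped Matrix.Norms.Frobenius in
lemma toEuclideanCLM_expNeg (A : Matrix (Fin m) (Fin m) ℝ) (t : ℝ) :
    Matrix.toEuclideanCLM (𝕜 := ℝ) (expNeg A t) =
      NormedSpace.exp (-t • Matrix.toEuclideanCLM (𝕜 := ℝ) A) := by
  let f := Matrix.toEuclideanCLM (𝕜 := ℝ) (n := Fin m)
  have hcont : Continuous f := LinearMap.continuous_of_finiteDimensional f.toAlgEquiv.toLinearMap
  exact (NormedSpace.map_exp f hcont (-t • A)).trans (by rw [map_smul])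

variable {Ω : Type*} [MeasurableSpace Ω] {P : Measure Ω}
  {A : Matrix (Fin m) (Fin m) ℝ} {σ : Matrix (Fin m) (Fin n) ℝ}
  {B : ℝ≥0 → Ω → EuclideanSpace ℝ (Fin n)} {x : EuclideanSpace ℝ (Fin m)}
  {X : ℝ≥0 → Ω → EuclideanSpace ℝ (Fin m)}

lemma IsOUSolution.ae_eval_zero (hB : IsStdBrownian B P) (hX : IsOUSolution A σ B P x X) :
    ∀ᵐ ω ∂P, X 0 ω = x := by
  filter_upwards [hX.equation, hB.ae_eval_zero] with ω heq hzero
  simpa [hzero] using heq 0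

lemma inner_stieltjesSum_exp (w : ℝ≥0 → EuclideanSpace ℝ (Fin n)) (v : EuclideanSpace ℝ (Fin m))
    (t : ℝ≥0) (N : ℕ) :
    ⟪v, stieltjesSum (fun s ↦ NormedSpace.exp ((s - t) • Matrix.toEuclideanCLM (𝕜 := ℝ) A))
        (fun s ↦ σ.toEuclideanLin (w s)) t N⟫ =
      stieltjesSum (fun s ↦ innerSL ℝ ((expNeg A (t - s) * σ)ᵀ.toEuclideanLin v)) w t N := by
  rw [stieltjesSum, stieltjesSum, inner_sum]
  refine Finset.sum_congr rfl fun k _ ↦ ?_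
  rw [← neg_sub (t : ℝ), ← toEuclideanCLM_expNeg, ← map_sub, innerSL_apply_apply,
    ← inner_toEuclideanLin, Matrix.toLpLin_mul (q := 2)]
  rfl

lemma IsOUSolution.ae_tendsto_stieltjesSum (hB : IsStdBrownian B P)
    (hX : IsOUSolution A σ B P x X) (t : ℝ≥0) (v : EuclideanSpace ℝ (Fin m)) :
    ∀ᵐ ω ∂P, Tendsto
      (stieltjesSum (fun s ↦ innerSL ℝ ((expNeg A (t - s) * σ)ᵀ.toEuclideanLin v)) (B · ω) t)
      atTop (𝓝 ⟪v, X t ω - (expNeg A t).toEuclideanLin x⟫) := by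
  filter_upwards [hX.continuous_paths, hX.equation, hX.ae_eval_zero hB] with ω hcont heq hzero
  have hlim := tendsto_stieltjesSum_exp (L := Matrix.toEuclideanCLM (𝕜 := ℝ) A) hcont heq t
  rw [← toEuclideanCLM_expNeg, hzero] at hlim
  refine ((innerSL ℝ v).continuous.tendsto _).comp hlim |>.congr fun N ↦ ?_
  exact inner_stieltjesSum_exp (B · ω) v t N

theorem IsOUSolution.map_eq [IsProbabilityMeasure P] (hB : IsStdBrownian B P)
    (hX : IsOUSolution A σ B P x X) (t : ℝ≥0) :
    P.map (X t) = multivariateGaussian ((expNeg A t).toEuclideanLin x) (covAt A σ t) := by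
  have := Measure.isProbabilityMeasure_map (hX.aemeasurable t)
  refine Measure.ext_of_charFun (funext fun v ↦ ?_)
  let g (s : ℝ) := (expNeg A s * σ)ᵀ.toEuclideanLin v
  have hg : Continuous g := (continuous_toEuclideanLin_apply v).comp
    ((continuous_expNeg A).matrix_mul continuous_const).matrix_transpose
  have hvar : ∫ s in (0 : ℝ)..t, ‖g (t - s)‖ ^ 2 = v ⬝ᵥ covAt A σ t *ᵥ v := by
    rw [intervalIntegral.integral_comp_sub_left (fun s ↦ ‖g s‖ ^ 2), sub_self, sub_zero,
      dotProduct_covAt_mulVec A σ t.coe_nonneg]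
  have hnoise := hB.integral_exp_of_ae_tendsto_stieltjesSum
    (hg.comp (continuous_const.sub continuous_id)) (hX.ae_tendsto_stieltjesSum hB t v)
  rw [Function.comp_def] at hnoise
  simp only [Pi.sub_apply, id_eq, hvar] at hnoise
  rw [charFun_multivariateGaussian (posSemidef_covAt A σ t.coe_nonneg), charFun_apply,
    integral_map (hX.aemeasurable t) (by fun_prop), sub_eq_add_neg, Complex.exp_add, ← neg_div,
    ← hnoise, ← integral_const_mul]
  refine integral_congr_ae (ae_of_all _ fun ω ↦ ?_)
  dsimp only
  rw [← Complex.exp_add, inner_sub_right, real_inner_comm]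
  push_cast
  ring_nf

end OrnsteinUhlenbeckLaw

section StationaryLaw

lemma multivariateGaussian_eq_map_const_add {ι : Type*} [Fintype ι] [DecidableEq ι]
    (a : EuclideanSpace ℝ ι) (S : Matrix ι ι ℝ) :
    multivariateGaussian a S = (multivariateGaussian 0 S).map (a + ·) := by
  rw [multivariateGaussian, multivariateGaussian, Measure.map_map (by fun_prop) (by fun_prop)]
  congr 1
  ext1 z
  simp

variable {m n : ℕ} {Ω : Type*} [MeasurableSpace Ω] {P : Measure Ω} [IsProbabilityMeasure P]
  {A : Matrix (Fin m) (Fin m) ℝ} {σ : Matrix (Fin m) (Fin n) ℝ}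
  {B : ℝ≥0 → Ω → EuclideanSpace ℝ (Fin n)}
  {X : EuclideanSpace ℝ (Fin m) → ℝ≥0 → Ω → EuclideanSpace ℝ (Fin m)}
  {μ : Measure (EuclideanSpace ℝ (Fin m))}

namespace IsStationaryLaw

lemma eq_conv (hB : IsStdBrownian B P) (hX : ∀ x, IsOUSolution A σ B P x (X x))
    (hμ : IsStationaryLaw P X μ) (t : ℝ≥0) :
    μ = (μ.map (expNeg A t).toEuclideanLin) ∗ multivariateGaussian 0 (covAt A σ t) := by
  have hL : Measurable (expNeg A t).toEuclideanLin :=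
    (LinearMap.continuous_of_finiteDimensional _).measurable
  ext S hS
  rw [← hμ t S hS, Measure.conv, Measure.map_apply measurable_add hS,
    Measure.prod_apply (measurable_add hS), lintegral_map (measurable_measure_prodMk_left
      (measurable_add hS)) hL]
  refine lintegral_congr fun x ↦ ?_
  rw [(hX x).map_eq hB, multivariateGaussian_eq_map_const_add, Measure.map_apply (by fun_prop) hS]
  rfl

variable [IsProbabilityMeasure μ]

lemma charFun_eq (hB : IsStdBrownian B P) (hX : ∀ x, IsOUSolution A σ B P x (X x))
    (hμ : IsStationaryLaw P X μ) (t : ℝ≥0) (v : EuclideanSpace ℝ (Fin m)) :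
    charFun μ v = charFun μ ((expNeg A t)ᵀ.toEuclideanLin v) *
      Complex.exp (-((v ⬝ᵥ covAt A σ t *ᵥ v : ℝ) : ℂ) / 2) := by
  have hL : Measurable (expNeg A t).toEuclideanLin :=
    (LinearMap.continuous_of_finiteDimensional _).measurable
  have := Measure.isProbabilityMeasure_map (μ := μ) hL.aemeasurable
  conv_lhs => rw [hμ.eq_conv hB hX t, charFun_conv,
    charFun_multivariateGaussian (posSemidef_covAt A σ t.coe_nonneg), charFun_apply,
    integral_map hL.aemeasurable (by fun_prop)]
  rw [charFun_apply]
  congr 1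
  · refine integral_congr_ae (ae_of_all _ fun x ↦ ?_)
    dsimp only
    rw [real_inner_comm, inner_toEuclideanLin, real_inner_comm]
  · simp [neg_div]

theorem eq_multivariateGaussian (hA : HasPositiveSpectrum A) (hB : IsStdBrownian B P)
    (hX : ∀ x, IsOUSolution A σ B P x (X x)) (hμ : IsStationaryLaw P X μ) :
    μ = multivariateGaussian 0 (covInfty A σ) := by
  refine Measure.ext_of_charFun (funext fun v ↦ ?_)
  have hcoe : Tendsto (fun t : ℝ≥0 ↦ (t : ℝ)) atTop atTop := NNReal.tendsto_coe_atTop.2 tendsto_id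
  have hmean : Tendsto (fun t : ℝ≥0 ↦ charFun μ ((expNeg A t)ᵀ.toEuclideanLin v)) atTop (𝓝 1) := by
    have hcont : Continuous fun M : Matrix (Fin m) (Fin m) ℝ ↦ charFun μ (Mᵀ.toEuclideanLin v) :=
      continuous_charFun.comp
        ((continuous_toEuclideanLin_apply v).comp continuous_id.matrix_transpose)
    have hlim := (hcont.tendsto 0).comp ((tendsto_expNeg hA).comp hcoe)
    rwa [Matrix.transpose_zero, map_zero, LinearMap.zero_apply, charFun_zero, probReal_univ,
      Complex.ofReal_one] at hlim
  have hcov : Tendsto (fun t : ℝ≥0 ↦ Complex.exp (-((v ⬝ᵥ covAt A σ t *ᵥ v : ℝ) : ℂ) / 2)) atTop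
      (𝓝 (Complex.exp (-((v ⬝ᵥ covInfty A σ *ᵥ v : ℝ) : ℂ) / 2))) := by
    have hcont : Continuous fun M : Matrix (Fin m) (Fin m) ℝ ↦
        Complex.exp (-((v ⬝ᵥ M *ᵥ v : ℝ) : ℂ) / 2) := by fun_prop
    exact (hcont.tendsto _).comp ((tendsto_covAt σ hA).comp hcoe)
  have hlim := tendsto_nhds_unique
    (tendsto_const_nhds.congr fun t ↦ hμ.charFun_eq hB hX t v) (hmean.mul hcov)
  rw [hlim, charFun_multivariateGaussian (posSemidef_covInfty σ hA)]
  simp [neg_div]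

end IsStationaryLaw

end StationaryLaw

theorem corollary2 {Ω : Type*} [MeasurableSpace Ω] (P : Measure Ω) [IsProbabilityMeasure P]
    (m n : ℕ) (A : Matrix (Fin m) (Fin m) ℝ) (hA : HasPositiveSpectrum A)
    (σ : Matrix (Fin m) (Fin n) ℝ)
    (B : ℝ≥0 → Ω → EuclideanSpace ℝ (Fin n)) (hB : IsStdBrownian B P)
    (X : EuclideanSpace ℝ (Fin m) → ℝ≥0 → Ω → EuclideanSpace ℝ (Fin m))
    (hX : ∀ x, IsOUSolution A σ B P x (X x))
    (μ : Measure (EuclideanSpace ℝ (Fin m))) [IsProbabilityMeasure μ] (hμ : IsStationaryLaw P X μ)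
    (t : ℝ≥0) (x : EuclideanSpace ℝ (Fin m)) :
    wasserstein 2 (P.map (X x t)) μ =
        wasserstein 2
          (multivariateGaussian ((expNeg A t).toEuclideanLin x) (covAt A σ t))
          (multivariateGaussian 0 (covInfty A σ)) ∧
      wasserstein 2 (P.map (X x t)) μ ≤
        ENNReal.ofReal (√(‖(expNeg A t).toEuclideanLin x‖ ^ 2 +
          frobeniusSq (CFC.sqrt (covAt A σ t) - CFC.sqrt (covInfty A σ)))) ∧
      wasserstein 2 (P.map (X x t)) μ ≤
        ENNReal.ofReal (√(‖(expNeg A t).toEuclideanLin x‖ ^ 2 +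
          m * frobeniusSq (CFC.sqrt (covAt A σ t) - CFC.sqrt (covInfty A σ)))) ∧
      (Commute (covAt A σ t) (covInfty A σ) →
        wasserstein 2 (P.map (X x t)) μ =
          ENNReal.ofReal (√(‖(expNeg A t).toEuclideanLin x‖ ^ 2 +
            frobeniusSq (CFC.sqrt (covAt A σ t) - CFC.sqrt (covInfty A σ))))) := by
  have hlaw := (hX x).map_eq hB t
  have hstat := hμ.eq_multivariateGaussian hA hB hX
  have hle := wasserstein_multivariateGaussian_le ((expNeg A t).toEuclideanLin x) 0 (covAt A σ t)
    (covInfty A σ)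
  rw [sub_zero] at hle
  rw [hlaw, hstat]
  refine ⟨rfl, hle, hle.trans ?_, fun h ↦ ?_⟩
  · gcongr
    rcases m.eq_zero_or_pos with rfl | hm
    · simp [frobeniusSq]
    · exact le_mul_of_one_le_left (frobeniusSq_nonneg _) (by exact_mod_cast hm)
  · have := wasserstein_multivariateGaussian_eq_of_commute ((expNeg A t).toEuclideanLin x) 0
      (posSemidef_covAt A σ t.coe_nonneg) (posSemidef_covInfty σ hA) h
    rwa [sub_zero] at this
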